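/- For $n\ge 1$ and $k\ge 1$, let $a_{n,k}=|\mathcal{S}^{1\prec n}_{n,k}(1243,1324)|$ be the number of permutations $\sigma$ of $\{1,\dots,n\}$ that avoid both patterns $1243$ and $1324$ and satisfy $\sigma^{-1}(n)-\sigma^{-1}(1)=k$, that is, in one-line notation the entry $1$ is to the left of the entry $n$ at distance $k$. For $1\le \ell\le n-1$ let $t_{n,\ell}$ be the number of the permutations counted by $a_{n,1}$ whose first entry is $\ell$, and let $s_n=\sum_{\ell=1}^{n-1}t_{n,\ell}$. Then for every $n\ge 2$, $$a_{n,1}=s_n=\binom{2n-4}{n-2},\qquad a_{n,n-1}=1,$$ $$a_{n,k}=a_{n,k+1}+a_{n-1,k-1}\quad\text{for } 2\le k\le n-2.$$ Consequently, $$a_{n,k}=\binom{2n-k-3}{n-2}\quad\text{for } 1\le k\le n-1.$$ This is the triangle A092392 of the OEIS, $T(N,K)=\binom{2N-K}{N}$ for $0\le K\le N$, that is, $a_{n,k}=T(n-2,k-1)$. -/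

import Mathlib

namespace PosStat

/-- A permutation of size `n` is an element of `Equiv.Perm (Fin n)`. Positions and entries are
numbered from `0` here, so position `i : Fin n` is position `i + 1` of the one-line notation, and
the value `σ i` is the entry `σ i + 1`. -/
def oneLine {n : ℕ} (σ : Equiv.Perm (Fin n)) : Fin n → ℕ := fun i => (σ i : ℕ) + 1

/-- `σ` contains the pattern `τ`: some subsequence of `σ` is order isomorphic to `τ`. -/
def Contains {m n : ℕ} (τ : Equiv.Perm (Fin m)) (σ : Equiv.Perm (Fin n)) : Prop :=
  ∃ f : Fin m → Fin n, StrictMono f ∧ ∀ i j : Fin m, σ (f i) < σ (f j) ↔ τ i < τ j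

/-- `σ` avoids every pattern in the set `P` (whose members may have different sizes). -/
def Avoids (P : Set (Σ m : ℕ, Equiv.Perm (Fin m))) {n : ℕ} (σ : Equiv.Perm (Fin n)) : Prop :=
  ∀ τ ∈ P, ¬ Contains τ.2 σ

/-- The set of `P`-avoiding permutations of size `n` that have the entry `a` to the left of the
entry `n` at distance `k` (that is, `σ⁻¹(n) - σ⁻¹(a) = k`), and all entries `b < a` to the right
of `n`. It is meant for `1 ≤ a ≤ n` and `1 ≤ k`. -/
def distClass (P : Set (Σ m : ℕ, Equiv.Perm (Fin m))) (a n k : ℕ) :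
    Set (Equiv.Perm (Fin n)) :=
  {σ | Avoids P σ ∧ ∃ p q : Fin n, oneLine σ p = a ∧ oneLine σ q = n ∧ (q : ℤ) - (p : ℤ) = k ∧
    ∀ r : Fin n, oneLine σ r < a → q < r}

/-- The pattern `1243`. -/
def pat1243 : Equiv.Perm (Fin 4) := Equiv.swap 2 3

/-- The pattern `1324`. -/
def pat1324 : Equiv.Perm (Fin 4) := Equiv.swap 1 2

theorem oneLine_pat1243 : oneLine pat1243 = ![1, 2, 4, 3] := by decide

theorem oneLine_pat1324 : oneLine pat1324 = ![1, 3, 2, 4] := by decide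

/-- The set of patterns `{1243, 1324}`. -/
def patterns : Set (Σ m : ℕ, Equiv.Perm (Fin m)) := {⟨4, pat1243⟩, ⟨4, pat1324⟩}

/-- `a_{n,k}`: the number of `(1243,1324)`-avoiding permutations of size `n` with `1` to the left
of `n` at distance `k`. -/
noncomputable def aNum (n k : ℕ) : ℕ := (distClass patterns 1 n k).ncard

/-- `t_{n,ℓ}`: the number of `(1243,1324)`-avoiding permutations of size `n` with `1` immediately
to the left of `n` and with first entry `ℓ`. -/
noncomputable def tNum (n l : ℕ) : ℕ :=
  {σ ∈ distClass patterns 1 n 1 | ∃ i : Fin n, (i : ℕ) = 0 ∧ oneLine σ i = l}.ncard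

/-- `s_n = ∑_{ℓ=1}^{n-1} t_{n,ℓ}`. -/
noncomputable def sNum (n : ℕ) : ℕ := ∑ l ∈ Finset.Icc 1 (n - 1), tNum n l

/-- The triangle A092392 of the OEIS: its entry in row `N` and column `K`, for `0 ≤ K ≤ N`, is the
binomial coefficient `C(2N - K, N)`. -/
def triangleA092392 (N K : ℕ) : ℕ := (2 * N - K).choose N

end PosStat

/-! Permutations grow by prepending a first entry `v`, values counted from 0. Both patterns begin
with their minimum, so prepending `v` to `τ` of size `m` preserves avoidance iff `τ` avoids both
patterns and its entries `≥ v` avoid 132 and 213 (`avoidsBoth_prepend`).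

For `1 ≤ v < m` the distance from minimum to maximum is unchanged, and the admissible `v` fill the
interval from `s = avoidingThreshold τ` to `m - 1`. The thresholds of the results run through the
same interval, each value once (`avoidingThreshold_prepend`, `sum_Icc_cycle`). With size minus
threshold as label, a node labelled `S` thus has children labelled `2, …, S + 1`: the Catalan
generating tree.

Prepending `0` creates a root: `τ` must avoid 132 and 213 and have its maximum in the `k`-th place.
For size `k + c` there are `layeredCount c` such `τ` (1 if `c = 0`, else `2 ^ (c - 1)`), each giving
a root labelled `k + c`. Adding up descendants gives `descendantSum`, which Pascal's rule evaluates
as a binomial coefficient. The recurrence and the special values follow from that closed form;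
`sNum` sorts the class of distance 1 by first entry. -/

namespace PosStat

open Equiv Finset

/-! ### Prepending a first entry -/

/-- The permutation whose first entry is `v` and whose other entries are order isomorphic
to `τ`. -/
def prepend {m : ℕ} (v : Fin (m + 1)) (τ : Perm (Fin m)) : Perm (Fin (m + 1)) :=
  ((finSuccEquiv' 0).trans (optionCongr τ)).trans (finSuccEquiv' v).symm

@[simp] theorem prepend_zero {m : ℕ} (v : Fin (m + 1)) (τ : Perm (Fin m)) :
    prepend v τ 0 = v := by
  simp [prepend]

theorem prepend_succ {m : ℕ} (v : Fin (m + 1)) (τ : Perm (Fin m)) (i : Fin m) :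
    prepend v τ i.succ = v.succAbove (τ i) := by
  have h : finSuccEquiv' (0 : Fin (m + 1)) i.succ = some i := by
    simp
  simp [prepend, h]

theorem val_prepend_succ {m : ℕ} (v : Fin (m + 1)) (τ : Perm (Fin m)) (i : Fin m) :
    (prepend v τ i.succ : ℕ) = if (τ i : ℕ) < v then (τ i : ℕ) else τ i + 1 := by
  rw [prepend_succ, Fin.succAbove]
  simp only [Fin.lt_def, Fin.val_castSucc]
  split_ifs <;> simp

theorem prepend_bijective (m : ℕ) :
    Function.Bijective (fun x : Fin (m + 1) × Perm (Fin m) => prepend x.1 x.2) := by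
  rw [Fintype.bijective_iff_injective_and_card]
  constructor
  · rintro ⟨v, τ⟩ ⟨w, ρ⟩ h
    have h0 : v = w := by simpa using congrArg (fun s => s 0) h
    subst h0
    refine Prod.ext rfl (Equiv.ext fun i => ?_)
    have hi := congrArg (fun s => s i.succ) h
    simpa [prepend_succ] using hi
  · simp [Fintype.card_perm, Nat.factorial_succ]

/-! ### Pattern conditions above a threshold -/

/-- The entries of `σ` of value at least `v` (counted from `0`) avoid `132` and `213`. -/
def UpperAvoids {m : ℕ} (σ : Perm (Fin m)) (v : ℕ) : Prop :=
  ∀ a b c : Fin m, a < b → b < c → v ≤ σ a → v ≤ σ b → v ≤ σ c →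
    ¬((σ a : ℕ) < σ c ∧ (σ c : ℕ) < σ b) ∧ ¬((σ b : ℕ) < σ a ∧ (σ a : ℕ) < σ c)

/-- The entries of `σ` of value at least `v` are increasing. -/
def UpperIncreasing {m : ℕ} (σ : Perm (Fin m)) (v : ℕ) : Prop :=
  ∀ a b : Fin m, a < b → v ≤ σ a → v ≤ σ b → (σ a : ℕ) < σ b

/-- `σ` avoids `1243` and `1324`. -/
def AvoidsBoth {m : ℕ} (σ : Perm (Fin m)) : Prop :=
  ∀ a b c d : Fin m, a < b → b < c → c < d →
    ¬((σ a : ℕ) < σ b ∧ (σ b : ℕ) < σ d ∧ (σ d : ℕ) < σ c) ∧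
    ¬((σ a : ℕ) < σ c ∧ (σ c : ℕ) < σ b ∧ (σ b : ℕ) < σ d)

theorem avoids_patterns_iff {m : ℕ} (σ : Perm (Fin m)) :
    Avoids patterns σ ↔ AvoidsBoth σ := by
  have key : ∀ τ : Perm (Fin 4), Contains τ σ ↔ ∃ a b c d : Fin m, a < b ∧ b < c ∧ c < d ∧
      ∀ i j : Fin 4, σ (![a, b, c, d] i) < σ (![a, b, c, d] j) ↔ τ i < τ j := by
    intro τ
    constructor
    · rintro ⟨f, hf, h⟩
      refine ⟨f 0, f 1, f 2, f 3, hf (by decide), hf (by decide), hf (by decide), ?_⟩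
      have : ![f 0, f 1, f 2, f 3] = f := by
        ext i; fin_cases i <;> rfl
      rwa [this]
    · rintro ⟨a, b, c, d, hab, hbc, hcd, h⟩
      refine ⟨![a, b, c, d], ?_, h⟩
      rw [Fin.strictMono_iff_lt_succ]
      intro i
      fin_cases i <;> assumption
  have e1 : pat1243 0 = 0 ∧ pat1243 1 = 1 ∧ pat1243 2 = 3 ∧ pat1243 3 = 2 := by decide
  have e2 : pat1324 0 = 0 ∧ pat1324 1 = 2 ∧ pat1324 2 = 1 ∧ pat1324 3 = 3 := by decide
  obtain ⟨p0, p1, p2, p3⟩ := e1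
  obtain ⟨q0, q1, q2, q3⟩ := e2
  simp only [Avoids, patterns, Set.mem_insert_iff, Set.mem_singleton_iff, forall_eq_or_imp,
    forall_eq, key]
  simp only [Fin.forall_fin_succ, IsEmpty.forall_iff, and_true, Fin.succ_zero_eq_one,
    Fin.succ_one_eq_two, Matrix.cons_val_zero, Matrix.cons_val_one, Matrix.cons_val,
    show (Fin.succ 2 : Fin 4) = 3 from rfl, p0, p1, p2, p3, q0, q1, q2, q3, Fin.lt_def]
  constructor
  · rintro ⟨h1, h2⟩ a b c d hab hbc hcd
    constructor
    · intro h
      refine h1 ⟨a, b, c, d, hab, hbc, hcd, ?_⟩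
      simp
      omega
    · intro h
      refine h2 ⟨a, b, c, d, hab, hbc, hcd, ?_⟩
      simp
      omega
  · intro h
    constructor
    · rintro ⟨a, b, c, d, hab, hbc, hcd, h1⟩
      refine (h a b c d hab hbc hcd).1 ?_
      simp at h1
      omega
    · rintro ⟨a, b, c, d, hab, hbc, hcd, h1⟩
      refine (h a b c d hab hbc hcd).2 ?_
      simp at h1
      omega

theorem UpperAvoids.mono {m : ℕ} {σ : Perm (Fin m)} {v w : ℕ} (h : UpperAvoids σ v)
    (hvw : v ≤ w) : UpperAvoids σ w :=
  fun a b c hab hbc ha hb hc => h a b c hab hbc (by omega) (by omega) (by omega)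

theorem UpperAvoids.avoidsBoth {m : ℕ} {σ : Perm (Fin m)} (h : UpperAvoids σ 0) :
    AvoidsBoth σ := by
  intro a b c d hab hbc hcd
  have h1 := h b c d hbc hcd (by omega) (by omega) (by omega)
  omega

theorem UpperIncreasing.mono {m : ℕ} {σ : Perm (Fin m)} {v w : ℕ} (h : UpperIncreasing σ v)
    (hvw : v ≤ w) : UpperIncreasing σ w :=
  fun a b hab ha hb => h a b hab (by omega) (by omega)

theorem UpperIncreasing.upperAvoids {m : ℕ} {σ : Perm (Fin m)} {v : ℕ}
    (h : UpperIncreasing σ v) : UpperAvoids σ v := by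
  intro a b c hab hbc ha hb hc
  have h1 := h a b hab ha hb
  have h2 := h b c hbc hb hc
  omega

theorem upperIncreasing_of_le {m : ℕ} (σ : Perm (Fin m)) {v : ℕ} (h : m ≤ v + 1) :
    UpperIncreasing σ v := by
  intro a b hab ha hb
  have : σ a = σ b := Fin.ext (by omega)
  exact absurd (σ.injective this) hab.ne

/-- The new first entry can only play the 1 of 1243 or 1324; what remains is 132 or 213 among larger
entries. -/
theorem avoidsBoth_prepend {m : ℕ} (v : Fin (m + 1)) (τ : Perm (Fin m)) :
    AvoidsBoth (prepend v τ) ↔ AvoidsBoth τ ∧ UpperAvoids τ v := by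
  constructor
  · intro h
    constructor
    · intro a b c d hab hbc hcd
      have h1 := h a.succ b.succ c.succ d.succ (by simpa) (by simpa) (by simpa)
      simp only [val_prepend_succ] at h1
      split_ifs at h1 <;> omega
    · intro a b c hab hbc ha hb hc
      have h1 := h 0 a.succ b.succ c.succ (Fin.succ_pos _) (by simpa) (by simpa)
      simp only [val_prepend_succ, prepend_zero, if_neg (not_lt.2 ha), if_neg (not_lt.2 hb),
        if_neg (not_lt.2 hc)] at h1
      omega
  · rintro ⟨h1, h2⟩ a b c d hab hbc hcd
    obtain ⟨b, rfl⟩ := Fin.exists_succ_eq_of_ne_zero (Fin.ne_zero_of_lt hab)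
    obtain ⟨c, rfl⟩ := Fin.exists_succ_eq_of_ne_zero (Fin.ne_zero_of_lt hbc)
    obtain ⟨d, rfl⟩ := Fin.exists_succ_eq_of_ne_zero (Fin.ne_zero_of_lt hcd)
    rw [Fin.succ_lt_succ_iff] at hbc hcd
    induction a using Fin.cases with
    | zero =>
      have h3 := h2 b c d hbc hcd
      simp only [val_prepend_succ, prepend_zero]
      split_ifs <;> omega
    | succ a =>
      have h3 := h1 a b c d (by simpa using hab) hbc hcd
      simp only [val_prepend_succ]
      split_ifs <;> omega

theorem upperAvoids_prepend_succ {m : ℕ} (v : Fin (m + 1)) (τ : Perm (Fin m)) {w : ℕ}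
    (hw : (v : ℕ) ≤ w) : UpperAvoids (prepend v τ) (w + 1) ↔ UpperAvoids τ w := by
  constructor
  · intro h a b c hab hbc ha hb hc
    have h1 := h a.succ b.succ c.succ (by simpa) (by simpa)
    simp only [val_prepend_succ] at h1
    split_ifs at h1 <;> omega
  · intro h a b c hab hbc
    obtain ⟨b, rfl⟩ := Fin.exists_succ_eq_of_ne_zero (Fin.ne_zero_of_lt hab)
    obtain ⟨c, rfl⟩ := Fin.exists_succ_eq_of_ne_zero (Fin.ne_zero_of_lt hbc)
    rw [Fin.succ_lt_succ_iff] at hbc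
    induction a using Fin.cases with
    | zero => simp only [prepend_zero]; omega
    | succ a =>
      have h3 := h a b c (by simpa using hab) hbc
      simp only [val_prepend_succ]
      split_ifs <;> omega

/-- The second condition excludes `v` as the 1 of a 132, the third excludes it as the 2 of a 213. -/
theorem upperAvoids_prepend_of_le {m : ℕ} (v : Fin (m + 1)) (τ : Perm (Fin m)) {w : ℕ}
    (hw : w ≤ v) : UpperAvoids (prepend v τ) w ↔ UpperAvoids τ w ∧ UpperIncreasing τ v ∧
      ∀ a b : Fin m, a < b → w ≤ τ a → (v : ℕ) ≤ τ b → (v : ℕ) ≤ τ a := by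
  constructor
  · intro h
    refine ⟨?_, ?_, ?_⟩
    · intro a b c hab hbc ha hb hc
      have h1 := h a.succ b.succ c.succ (by simpa) (by simpa)
      simp only [val_prepend_succ] at h1
      split_ifs at h1 <;> omega
    · intro a b hab ha hb
      have h1 := h 0 a.succ b.succ (Fin.succ_pos _) (by simpa)
      have h2 : (τ a : ℕ) ≠ τ b := fun e => hab.ne (τ.injective (Fin.ext e))
      simp only [val_prepend_succ, prepend_zero] at h1
      split_ifs at h1 <;> omega
    · intro a b hab ha hb
      have h1 := h 0 a.succ b.succ (Fin.succ_pos _) (by simpa)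
      simp only [val_prepend_succ, prepend_zero] at h1
      split_ifs at h1 <;> omega
  · rintro ⟨h1, h2, h3⟩ a b c hab hbc
    obtain ⟨b, rfl⟩ := Fin.exists_succ_eq_of_ne_zero (Fin.ne_zero_of_lt hab)
    obtain ⟨c, rfl⟩ := Fin.exists_succ_eq_of_ne_zero (Fin.ne_zero_of_lt hbc)
    rw [Fin.succ_lt_succ_iff] at hbc
    induction a using Fin.cases with
    | zero =>
      have h4 := h2 b c hbc
      have h5 := h3 b c hbc
      simp only [val_prepend_succ, prepend_zero]
      split_ifs <;> omega
    | succ a =>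
      have h4 := h1 a b c (by simpa using hab) hbc
      simp only [val_prepend_succ]
      split_ifs <;> omega

/-- If `r` is the least number `≥ b` such that the entries `≥ r` of `τ` increase, then the only
non-maximal first entry after which some smaller threshold `w ≥ b` is possible is `r`. -/
theorem upperAvoids_prepend_of_lt {m : ℕ} {v : Fin (m + 1)} {τ : Perm (Fin m)} {b r w : ℕ}
    (hv : (v : ℕ) < m) (hr : UpperIncreasing τ r)
    (hmin : ∀ u, b ≤ u → UpperIncreasing τ u → r ≤ u) (hb : b ≤ w) (hw : w < v) :
    UpperAvoids (prepend v τ) w ↔ (v : ℕ) = r ∧ UpperAvoids τ w := by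
  rw [upperAvoids_prepend_of_le v τ hw.le]
  obtain ⟨x, hx⟩ := τ.surjective ⟨v, hv⟩
  obtain ⟨y, hy⟩ := τ.surjective ⟨v - 1, by omega⟩
  have hx' : (τ x : ℕ) = v := by rw [hx]
  have hy' : (τ y : ℕ) = v - 1 := by rw [hy]
  have hxy : x ≠ y := by rintro rfl; omega
  constructor
  · rintro ⟨h1, h2, h3⟩
    -- If `r < v`, the values `v - 1` and `v` of `τ` appear in this order, and the new first entry
    -- completes a 213.
    refine ⟨le_antisymm (le_of_not_gt fun hlt => ?_) (hmin _ (by omega) h2), h1⟩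
    rcases lt_or_gt_of_ne hxy with h | h
    · have := hr x y h (by omega) (by omega)
      omega
    · have := h3 y x h (by omega) (by omega)
      omega
  · rintro ⟨hvr, h1⟩
    have hinc : UpperIncreasing τ v := hvr ▸ hr
    -- Otherwise the entries `≥ v - 1` would still increase, against the minimality of `r = v`.
    have hlt : x < y := by
      by_contra hcon
      have hyx : y < x := lt_of_le_of_ne (not_lt.1 hcon) hxy.symm
      have : UpperIncreasing τ (v - 1) := by
        intro a c hac ha hc
        have hne : (τ a : ℕ) ≠ τ c := fun e => hac.ne (τ.injective (Fin.ext e))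
        by_cases hc' : (τ c : ℕ) = v - 1
        · have : c = y := τ.injective (Fin.ext (by omega))
          subst this
          have hax : a < x := hac.trans hyx
          have := hinc a x hax (by omega) (by omega)
          omega
        · by_cases ha' : (τ a : ℕ) = v - 1
          · omega
          · exact hinc a c hac (by omega) (by omega)
      have := hmin _ (by omega) this
      omega
    refine ⟨h1, hinc, fun a c hac ha hc => ?_⟩
    by_contra hav
    -- An entry `τ a < v` before `τ c ≥ v` gives a 213 as `v, τ a, τ c` if `x < a`, and a 132 as `τ
    -- a, v, v - 1` if `a < x`.
    rcases lt_trichotomy x a with h | h | h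
    · have h4 := hinc x c (h.trans hac) (by omega) hc
      have := h1 x a c h hac (by omega) ha (by omega)
      omega
    · subst h; omega
    · have h5 : (τ a : ℕ) ≠ v - 1 := by
        intro e
        have : a = y := τ.injective (Fin.ext (by omega))
        subst this
        exact absurd (h.trans hlt) (lt_irrefl _)
      have := h1 a x y h hlt ha (by omega) (by omega)
      omega

/-! ### Thresholds and their change under prepending -/

/-- The least `v ≥ b` such that the entries `≥ v` of `σ` increase. -/
noncomputable def increasingThreshold {m : ℕ} (b : ℕ) (σ : Perm (Fin m)) : ℕ :=
  sInf {v | b ≤ v ∧ UpperIncreasing σ v}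

/-- The least `v ≥ 1` such that the entries `≥ v` of `σ` avoid `132` and `213`. -/
noncomputable def avoidingThreshold {m : ℕ} (σ : Perm (Fin m)) : ℕ :=
  sInf {v | 1 ≤ v ∧ UpperAvoids σ v}

theorem increasingThreshold_le {m b v : ℕ} {σ : Perm (Fin m)} (hb : b ≤ v)
    (h : UpperIncreasing σ v) : increasingThreshold b σ ≤ v :=
  Nat.sInf_le ⟨hb, h⟩

theorem increasingThreshold_spec {m : ℕ} (b : ℕ) (σ : Perm (Fin m)) :
    b ≤ increasingThreshold b σ ∧ UpperIncreasing σ (increasingThreshold b σ) :=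
  Nat.sInf_mem (s := {v | b ≤ v ∧ UpperIncreasing σ v})
    ⟨b + m, by omega, upperIncreasing_of_le σ (by omega)⟩

theorem avoidingThreshold_spec {m : ℕ} (σ : Perm (Fin m)) :
    1 ≤ avoidingThreshold σ ∧ UpperAvoids σ (avoidingThreshold σ) :=
  Nat.sInf_mem (s := {v | 1 ≤ v ∧ UpperAvoids σ v})
    ⟨m + 1, by omega, (upperIncreasing_of_le σ (by omega)).upperAvoids⟩

theorem avoidingThreshold_le_iff {m v : ℕ} {σ : Perm (Fin m)} (hv : 1 ≤ v) :
    avoidingThreshold σ ≤ v ↔ UpperAvoids σ v :=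
  ⟨fun h => (avoidingThreshold_spec σ).2.mono h, fun h => Nat.sInf_le ⟨hv, h⟩⟩

theorem avoidingThreshold_eq {m t : ℕ} {σ : Perm (Fin m)} (ht : 1 ≤ t)
    (h : ∀ w, 1 ≤ w → (UpperAvoids σ w ↔ t ≤ w)) : avoidingThreshold σ = t :=
  le_antisymm ((avoidingThreshold_le_iff ht).2 ((h t ht).2 le_rfl))
    ((h _ (avoidingThreshold_spec σ).1).1 (avoidingThreshold_spec σ).2)

theorem upperAvoids_prepend_self {m : ℕ} (v : Fin (m + 1)) (τ : Perm (Fin m)) :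
    UpperAvoids (prepend v τ) v ↔ UpperIncreasing τ v := by
  rw [upperAvoids_prepend_of_le v τ le_rfl]
  exact ⟨fun h => h.2.1, fun h => ⟨h.upperAvoids, h, fun a b _ ha _ => ha⟩⟩

theorem avoidingThreshold_le_increasingThreshold {m : ℕ} (σ : Perm (Fin m)) :
    avoidingThreshold σ ≤ increasingThreshold 1 σ :=
  (avoidingThreshold_le_iff (increasingThreshold_spec 1 σ).1).2
    (increasingThreshold_spec 1 σ).2.upperAvoids

/-- A threshold `w > v` ignores the new entry, `w = v` requires the entries `≥ v` of `τ` to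
increase, and `w < v` is possible only when `v` is the increasing threshold. -/
theorem avoidingThreshold_prepend {m : ℕ} {v : Fin (m + 1)} {τ : Perm (Fin m)}
    (hv1 : 1 ≤ (v : ℕ)) (hv : (v : ℕ) < m) (hτ : avoidingThreshold τ ≤ v) :
    avoidingThreshold (prepend v τ) =
      if (v : ℕ) < increasingThreshold 1 τ then (v : ℕ) + 1
      else if (v : ℕ) = increasingThreshold 1 τ then avoidingThreshold τ else v := by
  have hs := avoidingThreshold_spec τ
  have hr := increasingThreshold_spec 1 τ
  have hsr := avoidingThreshold_le_increasingThreshold τ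
  apply avoidingThreshold_eq
  · split_ifs <;> omega
  · intro w hw
    rcases lt_trichotomy w v with h | h | h
    · rw [upperAvoids_prepend_of_lt hv hr.2 (fun u => increasingThreshold_le) hw h,
        ← avoidingThreshold_le_iff hw]
      split_ifs <;> omega
    · subst h
      have : UpperIncreasing τ v ↔ increasingThreshold 1 τ ≤ v :=
        ⟨increasingThreshold_le hv1, hr.2.mono⟩
      rw [upperAvoids_prepend_self, this]
      split_ifs <;> omega
    · obtain ⟨w, rfl⟩ : ∃ u, w = u + 1 := ⟨w - 1, by omega⟩
      rw [upperAvoids_prepend_succ v τ (by omega), ← avoidingThreshold_le_iff (by omega)]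
      split_ifs <;> omega

theorem avoidingThreshold_prepend_zero {m : ℕ} {τ : Perm (Fin m)} (h : UpperAvoids τ 0) :
    avoidingThreshold (prepend 0 τ) = 1 := by
  refine avoidingThreshold_eq le_rfl fun w hw => ⟨fun _ => hw, fun _ => ?_⟩
  obtain ⟨w, rfl⟩ : ∃ u, w = u + 1 := ⟨w - 1, by omega⟩
  exact (upperAvoids_prepend_succ 0 τ (by simp)).2 (h.mono (by omega))

/-- The map is the cycle `s → s + 1 → ⋯ → r → s`, fixing everything above `r`. -/
theorem sum_Icc_cycle (φ : ℕ → ℕ) {s r t : ℕ} (hsr : s ≤ r) (hrt : r ≤ t) :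
    ∑ v ∈ Icc s t, φ (if v < r then v + 1 else if v = r then s else v) =
      ∑ j ∈ Icc s t, φ j := by
  refine sum_nbij' (fun v => if v < r then v + 1 else if v = r then s else v)
    (fun j => if j = s then r else if j ≤ r then j - 1 else j) ?_ ?_ ?_ ?_ (fun _ _ => rfl)
  all_goals
    intro v hv
    simp only [mem_Icc] at hv ⊢
    split_ifs <;> omega

/-! ### The counted classes under prepending -/

/-- The permutations of size `n` that avoid `1243` and `1324` and in which the maximum is `k`
places to the right of the minimum. -/
def MinMaxClass (n k : ℕ) (σ : Perm (Fin n)) : Prop :=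
  AvoidsBoth σ ∧ ∃ p q : Fin n, (σ p : ℕ) = 0 ∧ (σ q : ℕ) + 1 = n ∧ (q : ℕ) = p + k

/-- The permutations of size `n` that avoid `132` and `213` and whose maximum is at a position
(counted from `0`) satisfying `R`. -/
def MaxClass (n : ℕ) (R : ℕ → Prop) (σ : Perm (Fin n)) : Prop :=
  UpperAvoids σ 0 ∧ ∃ q : Fin n, (σ q : ℕ) + 1 = n ∧ R q

theorem minMaxClass_prepend_zero {m k : ℕ} (hk : 1 ≤ k) (τ : Perm (Fin m)) :
    MinMaxClass (m + 1) k (prepend 0 τ) ↔ MaxClass m (fun q => q + 1 = k) τ := by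
  rw [MinMaxClass, MaxClass, avoidsBoth_prepend]
  have h0 : ∀ p, ((prepend 0 τ p : Fin (m + 1)) : ℕ) = 0 ↔ p = 0 := by
    intro p
    rw [Fin.val_eq_zero_iff]
    exact ⟨fun h => (prepend 0 τ).injective (by rw [h, prepend_zero]),
      fun h => by rw [h, prepend_zero]⟩
  simp only [h0]
  constructor
  · rintro ⟨⟨-, h⟩, p, q, rfl, hq, hqk⟩
    refine ⟨by simpa using h, ?_⟩
    obtain ⟨q, rfl⟩ := Fin.exists_succ_eq_of_ne_zero (x := q) (by
      rintro rfl; simp at hqk; omega)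
    rw [val_prepend_succ] at hq
    simp at hq hqk
    exact ⟨q, by omega, by omega⟩
  · rintro ⟨h, q, hq, hqk⟩
    refine ⟨⟨h.avoidsBoth, by simpa using h⟩, 0, q.succ, rfl, ?_, ?_⟩
    · rw [val_prepend_succ]; simp; omega
    · simp; omega

theorem minMaxClass_prepend_last {m k : ℕ} (hk : 1 ≤ k) {v : Fin (m + 1)} (hv : (v : ℕ) = m)
    (τ : Perm (Fin m)) : ¬MinMaxClass (m + 1) k (prepend v τ) := by
  rintro ⟨-, p, q, -, hq, hqk⟩
  have : q = 0 := (prepend v τ).injective (Fin.ext (by rw [prepend_zero]; omega))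
  subst this
  simp at hqk
  omega

theorem minMaxClass_prepend {m k : ℕ} {v : Fin (m + 1)} (hv1 : 1 ≤ (v : ℕ))
    (hv : (v : ℕ) < m) (τ : Perm (Fin m)) :
    MinMaxClass (m + 1) k (prepend v τ) ↔ MinMaxClass m k τ ∧ avoidingThreshold τ ≤ v := by
  rw [MinMaxClass, MinMaxClass, avoidsBoth_prepend, avoidingThreshold_le_iff hv1]
  constructor
  · rintro ⟨⟨h1, h2⟩, p, q, hp, hq, hqk⟩
    obtain ⟨p, rfl⟩ := Fin.exists_succ_eq_of_ne_zero (x := p) (by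
      rintro rfl; simp only [prepend_zero] at hp; omega)
    obtain ⟨q, rfl⟩ := Fin.exists_succ_eq_of_ne_zero (x := q) (by
      rintro rfl; simp only [prepend_zero] at hq; omega)
    rw [val_prepend_succ] at hp hq
    simp only [Fin.val_succ] at hqk
    refine ⟨⟨h1, p, q, ?_, ?_, by omega⟩, h2⟩
    · split_ifs at hp; omega
    · split_ifs at hq <;> omega
  · rintro ⟨⟨h1, p, q, hp, hq, hqk⟩, h2⟩
    refine ⟨⟨h1, h2⟩, p.succ, q.succ, ?_, ?_, by simp; omega⟩
    · rw [val_prepend_succ, hp, if_pos (by omega)]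
    · rw [val_prepend_succ, if_neg (by omega)]; omega

theorem maxClass_prepend_last {m : ℕ} {R : ℕ → Prop} {v : Fin (m + 1)} (hv : (v : ℕ) = m)
    (τ : Perm (Fin m)) :
    MaxClass (m + 1) R (prepend v τ) ↔ UpperAvoids τ 0 ∧ R 0 := by
  have hτ : ∀ a, (τ a : ℕ) < v := fun a => by have := (τ a).2; omega
  have h1 : UpperAvoids (prepend v τ) 0 ↔ UpperAvoids τ 0 := by
    rw [upperAvoids_prepend_of_le v τ (by omega)]
    refine ⟨fun h => h.1, fun h => ⟨h, upperIncreasing_of_le τ (by omega), ?_⟩⟩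
    intro a b _ _ hb
    have := hτ b
    omega
  rw [MaxClass, h1]
  refine and_congr_right fun _ => ⟨?_, fun h => ⟨0, by simp [hv], h⟩⟩
  rintro ⟨q, hq, hR⟩
  have : q = 0 := (prepend v τ).injective (Fin.ext (by rw [prepend_zero]; omega))
  subst this
  exact hR

theorem maxClass_prepend {m : ℕ} {R : ℕ → Prop} {v : Fin (m + 1)} (hv : (v : ℕ) < m)
    (τ : Perm (Fin m)) :
    MaxClass (m + 1) R (prepend v τ) ↔
      (v : ℕ) = increasingThreshold 0 τ ∧ MaxClass m (fun q => R (q + 1)) τ := by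
  have hr := increasingThreshold_spec 0 τ
  have h1 : UpperAvoids (prepend v τ) 0 ↔
      (v : ℕ) = increasingThreshold 0 τ ∧ UpperAvoids τ 0 := by
    rcases Nat.eq_zero_or_pos (v : ℕ) with h0 | h0
    · have h2 := upperAvoids_prepend_self v τ
      rw [h0] at h2
      rw [h0, h2]
      constructor
      · intro h
        have := increasingThreshold_le le_rfl h
        exact ⟨by omega, h.upperAvoids⟩
      · rintro ⟨h, -⟩
        rw [h]
        exact hr.2
    · exact upperAvoids_prepend_of_lt hv hr.2 (fun u => increasingThreshold_le) le_rfl h0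
  rw [MaxClass, MaxClass, h1, and_assoc]
  refine and_congr_right fun _ => and_congr_right fun _ => ?_
  constructor
  · rintro ⟨q, hq, hR⟩
    obtain ⟨q, rfl⟩ := Fin.exists_succ_eq_of_ne_zero (x := q) (by
      rintro rfl; simp only [prepend_zero] at hq; omega)
    rw [val_prepend_succ] at hq
    refine ⟨q, ?_, by simpa using hR⟩
    split_ifs at hq <;> omega
  · rintro ⟨q, hq, hR⟩
    refine ⟨q.succ, ?_, by simpa using hR⟩
    rw [val_prepend_succ, if_neg (by omega)]
    omega

/-! ### Recursions for the counts -/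

theorem sum_perm_succ {m : ℕ} (f : Perm (Fin (m + 1)) → ℕ) :
    ∑ σ, f σ = ∑ τ : Perm (Fin m), ∑ v, f (prepend v τ) := by
  rw [← Equiv.sum_comp (Equiv.ofBijective _ (prepend_bijective m)) f, Fintype.sum_prod_type_right]
  rfl

open scoped Classical in
theorem sum_minMaxClass_succ {m k : ℕ} (hk : 1 ≤ k) (hm : 1 ≤ m) (φ : ℕ → ℕ) :
    ∑ σ with MinMaxClass (m + 1) k σ, φ (avoidingThreshold σ) =
      ∑ τ with MinMaxClass m k τ, ∑ j ∈ Icc (avoidingThreshold τ) (m - 1), φ j +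
      #{τ | MaxClass m (fun q => q + 1 = k) τ} * φ 1 := by
  rw [sum_filter, sum_perm_succ, card_eq_sum_ones, sum_mul, sum_filter, sum_filter,
    ← sum_add_distrib]
  refine sum_congr rfl fun τ _ => ?_
  have hs := (avoidingThreshold_spec τ).1
  set s := avoidingThreshold τ with hs_def
  set r := increasingThreshold 1 τ with hr_def
  -- `A` collects the first entries `v ≥ 1`, `B` the entry `v = 0` that creates a new minimum.
  let A : ℕ → ℕ := fun v => if v ∈ Icc s (m - 1) then
    (if MinMaxClass m k τ then
      φ (if v < r then v + 1 else if v = r then s else v) else 0) else 0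
  let B : ℕ → ℕ := fun v => if v = 0 then
    (if MaxClass m (fun q => q + 1 = k) τ then 1 * φ 1 else 0) else 0
  have hF : ∀ v : Fin (m + 1), (if MinMaxClass (m + 1) k (prepend v τ) then
      φ (avoidingThreshold (prepend v τ)) else 0) = A v + B v := by
    intro v
    simp only [A, B, mem_Icc]
    rcases Nat.eq_zero_or_pos (v : ℕ) with h0 | h0
    · have hv : v = 0 := Fin.ext h0
      subst hv
      rw [if_neg (by omega : ¬(s ≤ ((0 : Fin (m + 1)) : ℕ) ∧ _)), if_pos h0, zero_add]
      by_cases h : MaxClass m (fun q => q + 1 = k) τ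
      · rw [if_pos h, if_pos ((minMaxClass_prepend_zero hk τ).2 h),
          avoidingThreshold_prepend_zero h.1, one_mul]
      · rw [if_neg h, if_neg (mt (minMaxClass_prepend_zero hk τ).1 h)]
    · rw [if_neg (by omega : ¬(v : ℕ) = 0), add_zero]
      by_cases hv : (v : ℕ) = m
      · rw [if_neg (minMaxClass_prepend_last hk hv τ), if_neg (by omega)]
      · have hvm : (v : ℕ) < m := by omega
        simp only [minMaxClass_prepend h0 hvm τ]
        by_cases hsv : s ≤ v
        · rw [avoidingThreshold_prepend h0 hvm hsv, if_pos (by omega : s ≤ (v : ℕ) ∧ _)]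
          by_cases hc : MinMaxClass m k τ
          · rw [if_pos ⟨hc, hsv⟩, if_pos hc]
          · rw [if_neg fun h => hc h.1, if_neg hc]
        · rw [if_neg (fun h => hsv h.2), if_neg (fun h => hsv h.1)]
  rw [sum_congr rfl fun v _ => hF v, Fin.sum_univ_eq_sum_range (fun v => A v + B v),
    sum_add_distrib]
  congr 1
  · rw [sum_ite_mem, inter_eq_right.2 (fun v hv => by
      simp only [mem_Icc, mem_range] at hv ⊢; omega)]
    split_ifs with h
    · by_cases hsm : s ≤ m - 1
      · refine sum_Icc_cycle φ (avoidingThreshold_le_increasingThreshold τ) ?_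
        exact increasingThreshold_le (by omega) (upperIncreasing_of_le τ (by omega))
      · rw [Icc_eq_empty hsm, sum_empty, sum_empty]
    · simp
  · simp [B, sum_ite_eq']

-- Only two first entries keep 132 and 213 avoided: the new maximum, and `increasingThreshold 0 τ`.
open scoped Classical in
theorem card_maxClass_succ {m : ℕ} (hm : 1 ≤ m) (R : ℕ → Prop) :
    #{σ | MaxClass (m + 1) R σ} = #{τ | MaxClass m (fun q => R (q + 1)) τ} +
      if R 0 then #{τ : Perm (Fin m) | UpperAvoids τ 0} else 0 := by
  have hR : (if R 0 then #{τ : Perm (Fin m) | UpperAvoids τ 0} else 0) =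
      #{τ : Perm (Fin m) | UpperAvoids τ 0 ∧ R 0} := by
    split_ifs with h <;> simp [h]
  rw [hR, card_filter, card_filter, card_filter, sum_perm_succ, ← sum_add_distrib]
  refine sum_congr rfl fun τ _ => ?_
  have hr : increasingThreshold 0 τ < m := by
    have := increasingThreshold_le (σ := τ) (Nat.zero_le _)
      (upperIncreasing_of_le τ (v := m - 1) (by omega))
    omega
  rw [Fin.sum_univ_castSucc]
  congr 1
  · have h : ∀ i : Fin m, (if MaxClass (m + 1) R (prepend i.castSucc τ) then 1 else 0) =
        if i = ⟨increasingThreshold 0 τ, hr⟩ then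
          (if MaxClass m (fun q => R (q + 1)) τ then 1 else 0) else 0 := by
      intro i
      simp only [maxClass_prepend (v := i.castSucc) (by simp) τ, Fin.ext_iff, Fin.val_castSucc,
        ite_and]
    rw [sum_congr rfl fun i _ => h i, sum_ite_eq' univ]
    simp
  · simp only [maxClass_prepend_last (v := Fin.last m) (by simp) τ]

open scoped Classical in
/-- The number of permutations of size `n` that avoid `132` and `213`. -/
noncomputable def layeredCount (n : ℕ) : ℕ := #{τ : Perm (Fin n) | UpperAvoids τ 0}

theorem layeredCount_of_le_one {n : ℕ} (hn : n ≤ 1) : layeredCount n = 1 := by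
  classical
  have h : ∀ τ : Perm (Fin n), UpperAvoids τ 0 := fun τ =>
    (upperIncreasing_of_le τ (by omega)).upperAvoids
  rw [layeredCount, filter_true_of_mem fun τ _ => h τ, card_univ, Fintype.card_perm,
    Fintype.card_fin]
  interval_cases n <;> rfl

open scoped Classical in
theorem card_maxClass_true {n : ℕ} (hn : 1 ≤ n) :
    #{σ | MaxClass n (fun _ => True) σ} = layeredCount n := by
  refine congrArg card (filter_congr fun σ _ => ⟨fun h => h.1, fun h => ⟨h, ?_⟩⟩)
  obtain ⟨q, hq⟩ := σ.surjective ⟨n - 1, by omega⟩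
  exact ⟨q, by rw [hq]; simp; omega, trivial⟩

theorem layeredCount_succ {n : ℕ} (hn : 1 ≤ n) :
    layeredCount (n + 1) = 2 * layeredCount n := by
  rw [← card_maxClass_true (by omega), card_maxClass_succ hn, card_maxClass_true hn, if_pos trivial,
    layeredCount]
  omega

-- The `k` entries before the maximum are forced one by one; after the maximum any avoider of size
-- `c` may follow.
open scoped Classical in
theorem card_maxClass_eq (c k : ℕ) :
    #{σ | MaxClass (k + 1 + c) (fun q => q + 1 = k + 1) σ} = layeredCount c := by
  induction k with
  | zero =>
    rcases Nat.eq_zero_or_pos c with rfl | hc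
    · have h1 := card_maxClass_true le_rfl
      rw [layeredCount_of_le_one le_rfl] at h1
      rw [layeredCount_of_le_one (Nat.zero_le _)]
      refine Eq.trans ?_ h1
      refine congrArg card (filter_congr fun σ _ => ?_)
      simp [MaxClass]
    · have h0 := card_maxClass_succ hc (fun q => q + 1 = 0 + 1)
      rw [show 0 + 1 + c = c + 1 by omega, h0, if_pos rfl, layeredCount]
      simp [MaxClass]
  | succ k ih =>
    rw [show k + 1 + 1 + c = k + 1 + c + 1 by omega, card_maxClass_succ (by omega),
      if_neg (by omega), add_zero, ← ih]
    refine congrArg card (filter_congr fun σ _ => ?_)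
    simp [MaxClass]

/-! ### Descendants in the generating tree and binomial coefficients -/

/-- The number of nodes `p` levels below a node with label `S` in the generating tree in which
a node with label `S` has the children `2, …, S + 1`. -/
def descendants : ℕ → ℕ → ℕ
  | 0, _ => 1
  | p + 1, S => ∑ j ∈ range S, descendants p (j + 2)

theorem descendants_succ_zero (p : ℕ) : descendants (p + 1) 0 = 0 := by simp [descendants]

theorem descendants_succ_succ (p S : ℕ) :
    descendants (p + 1) (S + 1) = descendants (p + 1) S + descendants p (S + 2) := by
  simp [descendants, sum_range_succ]

/-- A ballot number, written without subtraction; Pascal's rule drives a double induction. -/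
theorem descendants_add_choose (p S : ℕ) :
    descendants (p + 1) (S + 1) + (2 * p + S + 2).choose p = (2 * p + S + 2).choose (p + 1) := by
  induction p generalizing S with
  | zero =>
    induction S with
    | zero => simp [descendants]
    | succ S ih =>
      rw [descendants_succ_succ]
      simp [descendants] at ih ⊢
  | succ p ihp =>
    induction S with
    | zero =>
      rw [descendants_succ_succ, descendants_succ_zero]
      have h1 : descendants (p + 1) (0 + 2) + (2 * p + 3).choose p = (2 * p + 3).choose (p + 1) :=
        ihp 1
      have h2 := Nat.choose_succ_succ' (2 * p + 3) p
      have h3 := Nat.choose_succ_succ' (2 * p + 3) (p + 1)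
      have h4 : (2 * p + 3).choose (p + 1 + 1) = (2 * p + 3).choose (p + 1) :=
        Nat.choose_symm_of_eq_add (by omega)
      rw [show 2 * (p + 1) + 0 + 2 = 2 * p + 3 + 1 by omega, h2, h3]
      omega
    | succ S ihS =>
      rw [descendants_succ_succ]
      have h2 := Nat.choose_succ_succ' (2 * (p + 1) + S + 2) p
      have h3 := Nat.choose_succ_succ' (2 * (p + 1) + S + 2) (p + 1)
      have h1 := ihp (S + 2)
      rw [show 2 * p + (S + 2) + 2 = 2 * (p + 1) + S + 2 by omega,
        show S + 2 + 1 = S + 1 + 2 by omega] at h1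
      rw [show 2 * (p + 1) + (S + 1) + 2 = 2 * (p + 1) + S + 2 + 1 by omega]
      omega

/-- The number of permutations of size `N + k + 1` in the class of distance `k`, see
`card_minMaxClass`. -/
noncomputable def descendantSum (N k : ℕ) : ℕ :=
  ∑ c ∈ range (N + 1), layeredCount c * descendants (N - c) (k + c)

theorem descendantSum_zero (k : ℕ) : descendantSum 0 k = 1 := by
  simp [descendantSum, descendants, layeredCount_of_le_one]

theorem descendantSum_succ_succ (N k : ℕ) :
    descendantSum (N + 1) (k + 1) = descendantSum (N + 1) k + descendantSum N (k + 2) := by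
  rw [descendantSum, descendantSum, descendantSum, sum_range_succ, sum_range_succ _ (N + 1)]
  conv_rhs => rw [add_right_comm, ← sum_add_distrib]
  congr 1
  · refine sum_congr rfl fun c hc => ?_
    rw [mem_range] at hc
    rw [show N + 1 - c = N - c + 1 by omega, show k + 1 + c = k + c + 1 by omega,
      descendants_succ_succ, mul_add, show k + 2 + c = k + c + 2 by omega]
  · simp [descendants]

/-- Boundary value for the induction on `k`. The term `c = 0` vanishes and shifting `c` doubles
`layeredCount`, except from 0 to 1; the extra summand corrects this. -/
theorem descendantSum_succ_zero (N : ℕ) :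
    descendantSum (N + 1) 0 + descendants N 1 = 2 * descendantSum N 1 := by
  rw [descendantSum, descendantSum, sum_range_succ', sum_range_succ', sum_range_succ',
    mul_add, mul_sum]
  have h : ∀ c ∈ range N,
      layeredCount (c + 1 + 1) * descendants (N + 1 - (c + 1 + 1)) (0 + (c + 1 + 1)) =
        2 * (layeredCount (c + 1) * descendants (N - (c + 1)) (1 + (c + 1))) := by
    intro c _
    rw [layeredCount_succ (by omega), mul_assoc, Nat.add_sub_add_right,
      show 0 + (c + 1 + 1) = 1 + (c + 1) by omega]
  rw [sum_congr rfl h]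
  simp [layeredCount_of_le_one, descendants_succ_zero]
  omega

theorem descendantSum_eq_choose (N k : ℕ) :
    descendantSum N (k + 1) = (2 * N + k).choose N := by
  induction N generalizing k with
  | zero => simp [descendantSum_zero]
  | succ N ihN =>
    have h0 : descendantSum (N + 1) 0 = (2 * N + 1).choose (N + 1) := by
      have h := descendantSum_succ_zero N
      rw [ihN 0] at h
      cases N with
      | zero => simp [descendants] at h ⊢; omega
      | succ N =>
        have h1 : descendants (N + 1) 1 + (2 * N + 2).choose N = (2 * N + 2).choose (N + 1) :=
          descendants_add_choose N 0
        have h2 := Nat.choose_succ_succ' (2 * N + 2) N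
        have h3 : (2 * N + 3).choose (N + 2) = (2 * N + 3).choose (N + 1) :=
          Nat.choose_symm_of_eq_add (by omega)
        simp only [add_zero, show 2 * (N + 1) = 2 * N + 2 by omega] at h ⊢
        rw [h3, h2]
        omega
    induction k with
    | zero =>
      rw [descendantSum_succ_succ, h0, ihN, add_comm]
      exact (Nat.choose_succ_succ' (2 * N + 1) N).symm
    | succ k ihk =>
      rw [descendantSum_succ_succ, ihk, ihN (k + 2),
        show 2 * (N + 1) + (k + 1) = 2 * N + (k + 2) + 1 by omega, Nat.choose_succ_succ',
        show 2 * (N + 1) + k = 2 * N + (k + 2) by omega, add_comm]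

/-! ### Counting the distance classes through the tree -/

open scoped Classical in
theorem sum_descendants_succ {m k : ℕ} (hk : 1 ≤ k) (hm : 1 ≤ m) (p : ℕ) :
    ∑ σ with MinMaxClass (m + 1) k σ, descendants p (m + 1 - avoidingThreshold σ) =
      ∑ τ with MinMaxClass m k τ, descendants (p + 1) (m - avoidingThreshold τ) +
      #{τ | MaxClass m (fun q => q + 1 = k) τ} * descendants p m := by
  rw [sum_minMaxClass_succ hk hm (fun j => descendants p (m + 1 - j))]
  congr 1
  refine sum_congr rfl fun τ _ => ?_
  have hs := (avoidingThreshold_spec τ).1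
  rw [descendants]
  -- The child with threshold `j` has label `m + 1 - j = (m - 1 - j) + 2`.
  refine sum_nbij' (fun j => m - 1 - j) (fun j => m - 1 - j) ?_ ?_ ?_ ?_ ?_
  all_goals
    intro j hj
    simp only [mem_Icc, mem_range] at hj ⊢
  any_goals omega
  congr 1
  omega

-- Keeping `p` free lets the induction trade one step of size for one generation; at `p = 0` the
-- left side is a cardinality.
open scoped Classical in
theorem sum_descendants {k : ℕ} (hk : 1 ≤ k) (N p : ℕ) :
    ∑ σ with MinMaxClass (k + N + 1) k σ, descendants p (k + N + 1 - avoidingThreshold σ) =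
      ∑ c ∈ range (N + 1), layeredCount c * descendants (p + N - c) (k + c) := by
  have hbase : ∀ c, #{τ | MaxClass (k + c) (fun q => q + 1 = k) τ} = layeredCount c := by
    intro c
    obtain ⟨k, rfl⟩ : ∃ j, k = j + 1 := ⟨k - 1, by omega⟩
    exact card_maxClass_eq c k
  induction N generalizing p with
  | zero =>
    have hempty : ∀ τ, ¬MinMaxClass k k τ := by
      rintro τ ⟨-, p, q, -, -, h⟩
      omega
    have h0 := hbase 0
    rw [add_zero] at h0
    rw [add_zero, sum_descendants_succ hk hk, h0, filter_false_of_mem fun τ _ => hempty τ]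
    simp
  | succ N ih =>
    rw [← add_assoc k N 1, sum_descendants_succ hk (by omega), ih, add_assoc k N 1, hbase,
      sum_range_succ _ (N + 1)]
    congr 1
    · refine sum_congr rfl fun c _ => ?_
      rw [show p + 1 + N = p + (N + 1) by omega]
    · rw [Nat.add_sub_cancel]

open scoped Classical in
theorem card_minMaxClass (N k : ℕ) :
    #{σ | MinMaxClass (k + 1 + N + 1) (k + 1) σ} = (2 * N + k).choose N := by
  have h := sum_descendants (k := k + 1) (by omega) N 0
  rw [zero_add] at h
  rw [← descendantSum_eq_choose, descendantSum, ← h, card_eq_sum_ones]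
  rfl

/-! ### Back to the original counts -/

theorem mem_distClass_iff {n k : ℕ} (σ : Perm (Fin n)) :
    σ ∈ distClass patterns 1 n k ↔ MinMaxClass n k σ := by
  simp only [distClass, Set.mem_ofPred_eq, MinMaxClass, avoids_patterns_iff, oneLine]
  refine and_congr_right fun _ => exists_congr fun p => exists_congr fun q => ?_
  constructor
  · rintro ⟨h1, h2, h3, -⟩
    exact ⟨by omega, h2, by omega⟩
  · rintro ⟨h1, h2, h3⟩
    exact ⟨by omega, h2, by omega, fun r hr => by omega⟩

theorem aNum_eq_choose {n k : ℕ} (hk : 1 ≤ k) (hkn : k ≤ n - 1) :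
    aNum n k = (2 * n - k - 3).choose (n - 2) := by
  classical
  obtain ⟨k, rfl⟩ : ∃ j, k = j + 1 := ⟨k - 1, by omega⟩
  obtain ⟨N, rfl⟩ : ∃ N, n = k + 1 + N + 1 := ⟨n - k - 2, by omega⟩
  have h : distClass patterns 1 (k + 1 + N + 1) (k + 1) =
      ({σ | MinMaxClass (k + 1 + N + 1) (k + 1) σ} : Finset (Perm (Fin (k + 1 + N + 1)))) := by
    ext σ
    simp [mem_distClass_iff]
  rw [aNum, h, Set.ncard_coe_finset, card_minMaxClass,
    show 2 * (k + 1 + N + 1) - (k + 1) - 3 = 2 * N + k by omega]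
  exact Nat.choose_symm_of_eq_add (by omega)

theorem aNum_one_eq_sNum {n : ℕ} (hn : 2 ≤ n) : aNum n 1 = sNum n := by
  classical
  let X : Finset (Perm (Fin n)) := {σ | MinMaxClass n 1 σ}
  let z : Fin n := ⟨0, by omega⟩
  have hX : distClass patterns 1 n 1 = X := by
    ext σ
    simp [X, mem_distClass_iff]
  have ht : ∀ l, tNum n l = #{σ ∈ X | oneLine σ z = l} := by
    intro l
    rw [tNum, hX, ← Set.ncard_coe_finset]
    congr 1
    ext σ
    simp only [Set.mem_ofPred_eq, coe_filter, mem_coe]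
    refine and_congr_right fun _ => ⟨?_, fun h => ⟨z, rfl, h⟩⟩
    rintro ⟨i, hi, h⟩
    rwa [show z = i from Fin.ext hi.symm]
  rw [aNum, hX, Set.ncard_coe_finset, sNum, sum_congr rfl fun l _ => ht l]
  refine card_eq_sum_card_fiberwise fun σ hσ => ?_
  obtain ⟨-, p, q, hp, hq, hpq⟩ := (mem_filter.1 hσ).2
  -- The first entry is not `n`, since 1 stands before `n`; hence the range of `ℓ` stops at `n - 1`.
  have h1 : (σ z : ℕ) + 1 ≠ n := by
    intro h
    have : z = q := σ.injective (Fin.ext (by omega))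
    subst this
    simp [z] at hpq
  have := (σ z).2
  simp only [oneLine, coe_Icc, Set.mem_Icc]
  omega

end PosStat

theorem mainTheorem10 (n : ℕ) (hn : 2 ≤ n) :
    PosStat.aNum n 1 = PosStat.sNum n ∧
    PosStat.sNum n = (2 * n - 4).choose (n - 2) ∧
    PosStat.aNum n (n - 1) = 1 ∧
    (∀ k : ℕ, 2 ≤ k → k ≤ n - 2 →
      PosStat.aNum n k = PosStat.aNum n (k + 1) + PosStat.aNum (n - 1) (k - 1)) ∧
    (∀ k : ℕ, 1 ≤ k → k ≤ n - 1 →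
      PosStat.aNum n k = (2 * n - k - 3).choose (n - 2)) ∧
    (∀ k : ℕ, 1 ≤ k → k ≤ n - 1 →
      PosStat.aNum n k = PosStat.triangleA092392 (n - 2) (k - 1)) := by
  have hs := PosStat.aNum_one_eq_sNum hn
  refine ⟨hs, ?_, ?_, ?_, fun k => PosStat.aNum_eq_choose, ?_⟩
  · rw [← hs, PosStat.aNum_eq_choose le_rfl (by omega)]
    rfl
  · rw [PosStat.aNum_eq_choose (by omega) le_rfl, show 2 * n - (n - 1) - 3 = n - 2 by omega,
      Nat.choose_self]
  · intro k hk hkn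
    rw [PosStat.aNum_eq_choose (by omega) (by omega), PosStat.aNum_eq_choose (by omega) (by omega),
      PosStat.aNum_eq_choose (by omega) (by omega),
      show 2 * n - k - 3 = 2 * n - (k + 1) - 3 + 1 by omega,
      show 2 * (n - 1) - (k - 1) - 3 = 2 * n - (k + 1) - 3 by omega,
      show n - 2 = n - 1 - 2 + 1 by omega, Nat.choose_succ_succ', add_comm]
  · intro k hk hkn
    rw [PosStat.aNum_eq_choose hk hkn, PosStat.triangleA092392,
      show 2 * (n - 2) - (k - 1) = 2 * n - k - 3 by omega]
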